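/- All graphs are finite and simple. A graph $G$ is a \emph{unit interval graph} if one can assign to each vertex $v$ a closed real interval $[l(v),l(v)+1]$ so that two distinct vertices are adjacent if and only if their intervals intersect. For $n,m\ge 0$, let $H_{n,m}$ be the graph with vertices $v_{i,j}$ ($1\le i\le n$, $1\le j\le m$) in which, for each $i$, the vertices $v_{i,1},\dots,v_{i,m}$ form a clique, for each $i<n$ the vertex $v_{i,j}$ is adjacent to $v_{i+1,1},\dots,v_{i+1,j}$, and there are no other edges. The \emph{clique-width} of a graph is the minimum number of labels needed to construct it by the following operations: creating a new vertex with label $i$; taking the disjoint union of two labelled graphs; joining every vertex with label $i$ to every vertex with label $j$, where $i\ne j$; renaming label $i$ to $j$ (the graph without vertices has clique-width $0$). For every natural number $k$ there is a constant $c(k)$ such that every unit interval graph $G$ that has no induced subgraph isomorphic to $H_{k,k}$ has clique-width at most $c(k)$. Moreover, one may take $c(k)=12k^3+72k^2-36k+96$. -/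

import Mathlib

/-- `G` is a unit interval graph: to each vertex `v` one can associate a closed interval
`[l v, l v + 1]` of the real line so that two distinct vertices are adjacent exactly when their
intervals intersect. -/
def IsUnitIntervalGraph {V : Type*} (G : SimpleGraph V) : Prop :=
  ∃ l : V → ℝ, ∀ u v : V, G.Adj u v ↔
    u ≠ v ∧ (Set.Icc (l u) (l u + 1) ∩ Set.Icc (l v) (l v + 1)).Nonempty

/-- The canonical unit interval graph `H_{n,m}`: the vertex `(i, j)` stands for `v_{i,j}`; every row
is a clique, `v_{i,j}` is adjacent to `v_{i+1,j'}` exactly when `j' ≤ j`, and there are no other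
edges (`SimpleGraph.fromRel` symmetrizes the relation and removes loops). -/
def canonicalGraph (n m : ℕ) : SimpleGraph (Fin n × Fin m) :=
  SimpleGraph.fromRel fun p q =>
    p.1 = q.1 ∨ ((p.1 : ℕ) + 1 = (q.1 : ℕ) ∧ q.2 ≤ p.2)

/-- Expressions built from the four clique-width operations with labels in `L`: a new vertex with
label `i`, disjoint union, joining all vertices with label `i` to all vertices with label `j`
(where `i ≠ j`), and renaming label `i` to `j`. -/
inductive CWExpr (L : Type) : Type
  | vertex (i : L) : CWExpr L
  | union (s t : CWExpr L) : CWExpr L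
  | join (i j : L) (hij : i ≠ j) (s : CWExpr L) : CWExpr L
  | rename (i j : L) (s : CWExpr L) : CWExpr L

namespace CWExpr

/-- The vertex set of the labelled graph built by an expression. -/
def Vert {L : Type} : CWExpr L → Type
  | vertex _ => Unit
  | union s t => Vert s ⊕ Vert t
  | join _ _ _ s => Vert s
  | rename _ _ s => Vert s

/-- The labelling of the labelled graph built by an expression. -/
def label {L : Type} [DecidableEq L] : (e : CWExpr L) → e.Vert → L
  | vertex i => fun _ => i
  | union s t => Sum.elim (label s) (label t)
  | join _ _ _ s => label s
  | rename i j s => fun v => if label s v = i then j else label s v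

/-- The edges of the labelled graph built by an expression. -/
def graph {L : Type} [DecidableEq L] : (e : CWExpr L) → SimpleGraph e.Vert
  | vertex _ => (⊥ : SimpleGraph Unit)
  | union s t => SimpleGraph.sum (graph s) (graph t)
  | join i j _ s => graph s ⊔ SimpleGraph.fromRel fun u v => label s u = i ∧ label s v = j
  | rename _ _ s => graph s

end CWExpr

/-- `G` can be constructed with `n` labels by the four clique-width operations. The graph without
vertices needs no operation, hence no label. -/
def ConstructibleWithLabels {V : Type*} (G : SimpleGraph V) (n : ℕ) : Prop :=
  IsEmpty V ∨ ∃ e : CWExpr (Fin n), Nonempty (G ≃g e.graph)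

/-- The clique-width of `G`: the minimum number of labels needed to construct `G`
(it is `⊤` if `G` cannot be constructed, which happens only for infinite graphs). -/
noncomputable def cliqueWidth {V : Type*} (G : SimpleGraph V) : ℕ∞ :=
  ⨅ (n : ℕ) (_ : ConstructibleWithLabels G n), (n : ℕ∞)

/-! Integer parts of left endpoints give levels, fractional parts give phases. The parent of a
vertex is the least phase on the previous level that is at least its own; parents preserve the order
of phases, and the phase `1` stands for a missing ancestor. A phase is tall if it has a descendant
`q` levels further on. Distinct tall phases on one level have disjoint ancestor chains, so excluding
`H_{q+1,q+1}` bounds their number (`ncard_tall_le`).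

Every vertex has a tall ancestor at distance at most `q`; the vertices are inserted in order of the
level of the nearest one (the base), then of phase. Towards later vertices of the same base,
adjacency depends on levels only (`adj_iff_of_key_le`). Towards a larger base, the few tall phases
on the level after the base decide it (`adj_of_base_lt`). Each initial segment thus has boundedly
many neighbourhood types towards its complement, and `cliqueWidth_le_of_initial_classes` turns this
into a bound on clique-width. -/

/-- The labelled graph `(G, lab)` is, up to isomorphism, the value of an expression. -/
def IsBuilt {V : Type*} {L : Type} [DecidableEq L] (G : SimpleGraph V) (lab : V → L) : Prop :=
  ∃ (e : CWExpr L) (φ : G ≃g e.graph), ∀ v, e.label (φ v) = lab v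

/-! ### Clique-width operations on labelled graphs -/

namespace IsBuilt

variable {V W : Type*} {L : Type} [DecidableEq L]

theorem of_iso {G : SimpleGraph V} {H : SimpleGraph W} {lab : W → L} (h : IsBuilt H lab)
    (ψ : G ≃g H) : IsBuilt G (fun v => lab (ψ v)) := by
  obtain ⟨e, φ, hφ⟩ := h
  exact ⟨e, ψ.trans φ, fun v => hφ (ψ v)⟩

theorem congr {G H : SimpleGraph V} {lab lab' : V → L} (h : IsBuilt H lab')
    (hG : ∀ u v, G.Adj u v ↔ H.Adj u v) (hlab : ∀ v, lab v = lab' v) : IsBuilt G lab := by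
  obtain rfl : G = H := SimpleGraph.ext (funext₂ fun u v => propext (hG u v))
  obtain rfl : lab = lab' := funext hlab
  exact h

theorem vertex [Unique V] (G : SimpleGraph V) (lab : V → L) : IsBuilt G lab := by
  refine ⟨.vertex (lab default), ⟨Equiv.ofUnique V Unit, ?_⟩, fun v => ?_⟩
  · intro a b
    obtain rfl : a = b := Subsingleton.elim _ _
    exact iff_of_false (SimpleGraph.irrefl _) (SimpleGraph.irrefl _)
  · rw [Subsingleton.elim v default]
    rfl

theorem sum {G : SimpleGraph V} {H : SimpleGraph W} {lab : V → L} {lab' : W → L}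
    (hG : IsBuilt G lab) (hH : IsBuilt H lab') :
    IsBuilt (SimpleGraph.sum G H) (Sum.elim lab lab') := by
  obtain ⟨e, φ, hφ⟩ := hG
  obtain ⟨e', φ', hφ'⟩ := hH
  refine ⟨.union e e', ⟨Equiv.sumCongr φ.toEquiv φ'.toEquiv, ?_⟩, ?_⟩
  · rintro (a | a) (b | b)
    · exact φ.map_adj_iff
    · exact Iff.rfl
    · exact Iff.rfl
    · exact φ'.map_adj_iff
  · rintro (a | a)
    · exact hφ a
    · exact hφ' a

theorem join {G : SimpleGraph V} {lab : V → L} (h : IsBuilt G lab) {i j : L} (hij : i ≠ j) :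
    IsBuilt (G ⊔ SimpleGraph.fromRel fun u v => lab u = i ∧ lab v = j) lab := by
  obtain ⟨e, φ, hφ⟩ := h
  refine ⟨.join i j hij e, ⟨φ.toEquiv, ?_⟩, hφ⟩
  intro a b
  have h1 : e.graph.Adj (φ a) (φ b) ↔ G.Adj a b := φ.map_adj_iff
  have h2 : φ a ≠ φ b ↔ a ≠ b := φ.injective.ne_iff
  change (e.graph ⊔ SimpleGraph.fromRel fun u v => e.label u = i ∧ e.label v = j).Adj
    (φ a) (φ b) ↔ _
  simp only [SimpleGraph.sup_adj, SimpleGraph.fromRel_adj, hφ, h1, h2]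

theorem rename {G : SimpleGraph V} {lab : V → L} (h : IsBuilt G lab) (i j : L) :
    IsBuilt G (fun v => if lab v = i then j else lab v) := by
  obtain ⟨e, φ, hφ⟩ := h
  refine ⟨.rename i j e, φ, fun v => ?_⟩
  change (if e.label (φ v) = i then j else e.label (φ v)) = _
  rw [hφ]

theorem join_finset {G : SimpleGraph V} {lab : V → L} (h : IsBuilt G lab) (i : L)
    (A : Finset L) (hi : i ∉ A) :
    IsBuilt (G ⊔ SimpleGraph.fromRel fun u v => lab u = i ∧ lab v ∈ A) lab := by
  induction A using Finset.induction_on with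
  | empty =>
    convert h using 1
    ext u v
    simp
  | insert a A ha ih =>
    rw [Finset.mem_insert, not_or] at hi
    convert (ih hi.2).join hi.1 using 1
    ext u v
    simp only [SimpleGraph.sup_adj, SimpleGraph.fromRel_adj, Finset.mem_insert]
    tauto

/-- Since `f` maps `A` outside `A`, the renamings can be done one at a time without cascading. -/
theorem rename_finset {G : SimpleGraph V} {lab : V → L} (h : IsBuilt G lab) (f : L → L)
    (A : Finset L) (hf : ∀ a ∈ A, f a ∉ A) :
    IsBuilt G (fun v => if lab v ∈ A then f (lab v) else lab v) := by
  suffices H : ∀ B ⊆ A, IsBuilt G (fun v => if lab v ∈ B then f (lab v) else lab v) from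
    H A subset_rfl
  intro B
  induction B using Finset.induction_on with
  | empty => intro _; simpa using h
  | insert a B ha ih =>
    intro hB
    rw [Finset.insert_subset_iff] at hB
    convert (ih hB.2).rename a (f a) using 2 with v
    by_cases h1 : lab v ∈ B
    · have h2 : f (lab v) ≠ a := fun h2 => hf _ (hB.2 h1) (h2 ▸ hB.1)
      simp [h1, h2]
    · by_cases h2 : lab v = a
      · simp [h2, ha]
      · simp [h1, h2]

theorem map {L' : Type} [DecidableEq L'] {G : SimpleGraph V} {lab : V → L} (h : IsBuilt G lab)
    {f : L → L'} (hf : Function.Injective f) : IsBuilt G (fun v => f (lab v)) := by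
  obtain ⟨e, φ, hφ⟩ := h
  suffices H : ∀ e : CWExpr L, IsBuilt e.graph (fun v => f (e.label v)) by
    convert (H e).of_iso φ using 2 with v
    rw [hφ]
  intro e
  induction e with
  | vertex i => exact @IsBuilt.vertex Unit _ _ _ _ _
  | union s t hs ht => exact (hs.sum ht).congr (fun _ _ => Iff.rfl) (by rintro (v | v) <;> rfl)
  | join i j hij s hs =>
    refine (hs.join (hf.ne hij)).congr (fun u v => ?_) fun _ => rfl
    simp only [hf.eq_iff]
    rfl
  | rename i j s hs =>
    refine (hs.rename (f i) (f j)).congr (fun _ _ => Iff.rfl) fun v => ?_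
    simp only [hf.eq_iff]
    exact apply_ite f _ _ _

theorem cliqueWidth_le [Fintype L] {G : SimpleGraph V} {lab : V → L} (h : IsBuilt G lab) :
    cliqueWidth G ≤ (Fintype.card L : ℕ∞) := by
  obtain ⟨e, φ, -⟩ := h.map (Fintype.equivFin L).injective
  exact iInf₂_le (Fintype.card L) (Or.inr ⟨e, ⟨φ⟩⟩)

/-- Adding one vertex `v` to a built graph on `P`, and relabelling afterwards. The labels
`some (inl c)` are the working labels, `some (inr c)` are used to relabel, and `none` is the label
of the new vertex. -/
theorem insert_vertex {C : Type} [Fintype C] [DecidableEq C] {G : SimpleGraph V} {P : Set V}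
    {lab : V → C} (h : IsBuilt (G.induce P) (fun u => (some (.inl (lab u)) : Option (C ⊕ C))))
    {v : V} (hv : v ∉ P) (hadj : ∀ u ∈ P, ∀ u' ∈ P, lab u = lab u' → (G.Adj u v ↔ G.Adj u' v))
    (f : C → C) (c : C) {lab' : V → C} (hP : ∀ u ∈ P, lab' u = f (lab u)) (hlab' : lab' v = c) :
    IsBuilt (G.induce (insert v P)) (fun u => (some (.inl (lab' u)) : Option (C ⊕ C))) := by
  classical
  have h0 := h.sum (IsBuilt.vertex (⊥ : SimpleGraph Unit) (fun _ => (none : Option (C ⊕ C))))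
  let A : Finset (Option (C ⊕ C)) :=
    Finset.univ.filter fun x => ∃ u ∈ P, G.Adj u v ∧ x = some (.inl (lab u))
  have hA : ∀ u ∈ P, (some (.inl (lab u)) ∈ A ↔ G.Adj u v) := by
    intro u hu
    simp only [A, Finset.mem_filter, Finset.mem_univ, true_and, Option.some.injEq, Sum.inl.injEq]
    constructor
    · rintro ⟨u', hu', h1, h2⟩
      exact (hadj u hu u' hu' h2).2 h1
    · exact fun h1 => ⟨u, hu, h1, rfl⟩
  have h1 := h0.join_finset none A (by simp [A])
  -- The relabelling passes through the spare copy `inr` and back, because `f` may send one working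
  -- label to another that is still in use.
  have h2 := h1.rename_finset
    (fun x => Option.elim x (some (.inr c)) fun y => some (.inr (f (Sum.elim id id y))))
    (Finset.univ.filter fun x => ∀ b, x ≠ some (.inr b)) (by rintro (_ | _ | _) <;> simp)
  have h3 := h2.rename_finset
    (fun x => Option.elim x none fun y => some (.inl (Sum.elim id id y)))
    (Finset.univ.filter fun x => ∃ b, x = some (.inr b)) (by rintro (_ | _ | _) <;> simp)
  let E : (insert v P : Set V) ≃ P ⊕ Unit :=
    (Equiv.Set.insert hv).trans (Equiv.sumCongr (Equiv.refl _) (Equiv.ofUnique _ _))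
  have hEl : ∀ u : P, E.symm (.inl u) = ⟨u, Or.inr u.2⟩ := fun u => rfl
  have hEr : E.symm (.inr ()) = ⟨v, Or.inl rfl⟩ := rfl
  refine (h3.of_iso (G := G.induce (insert v P)) ⟨E, ?_⟩).congr (fun _ _ => Iff.rfl) ?_
  · intro a b
    obtain ⟨a, rfl⟩ := E.symm.surjective a
    obtain ⟨b, rfl⟩ := E.symm.surjective b
    rw [E.apply_symm_apply, E.apply_symm_apply]
    rcases a with a | ⟨⟩ <;> rcases b with b | ⟨⟩
    · simp [hEl]
    · simp [hEl, hEr, hA a a.2]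
    · simp [hEl, hEr, hA b b.2, G.adj_comm v]
    · simp
  · intro u
    obtain ⟨x, rfl⟩ := E.symm.surjective u
    simp only [RelIso.coe_fn_mk, E.apply_symm_apply]
    rcases x with x | ⟨⟩
    · simp [hEl, hP x x.2]
    · simp [hEr, hlab']

end IsBuilt

/-! ### Clique-width from neighbourhood types of initial segments -/

/-- If every initial segment of a finite graph, with respect to the preorder given by `κ`, has at
most `|C|` neighbourhood types towards its complement, then the clique-width is at most
`2|C| + 1`. -/
theorem cliqueWidth_le_of_initial_classes {V K : Type*} [Finite V] [LinearOrder K] {C : Type}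
    [Fintype C] (G : SimpleGraph V) (κ : V → K)
    (hC : ∀ P : Set V, P.Nonempty → (∀ u ∈ P, ∀ w ∉ P, κ u ≤ κ w) →
      ∃ g : V → C, ∀ u ∈ P, ∀ u' ∈ P, g u = g u' → ∀ w ∉ P, G.Adj u w ↔ G.Adj u' w) :
    cliqueWidth G ≤ ((2 * Fintype.card C + 1 : ℕ) : ℕ∞) := by
  classical
  have := Fintype.ofFinite V
  rcases isEmpty_or_nonempty V with hV | hV
  · exact (iInf₂_le (0 : ℕ) (Or.inl hV)).trans (by simp)
  have main : ∀ P : Finset V, P.Nonempty → (∀ u ∈ P, ∀ w ∉ P, κ u ≤ κ w) →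
      ∃ lab : V → C, (∀ u ∈ P, ∀ u' ∈ P, lab u = lab u' → ∀ w ∉ P, G.Adj u w ↔ G.Adj u' w) ∧
        IsBuilt (G.induce (P : Set V)) (fun u => (some (.inl (lab u)) : Option (C ⊕ C))) := by
    intro P
    induction P using Finset.strongInduction with
    | H P ih =>
      intro hne hP
      obtain ⟨g, hg⟩ := hC P hne (by simpa using hP)
      simp only [Finset.mem_coe] at hg
      obtain ⟨v, hv, hmax⟩ := P.exists_max_image κ hne
      rcases (P.erase v).eq_empty_or_nonempty with h0 | h0
      · obtain rfl : P = {v} := by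
          rw [← Finset.insert_erase hv, h0]
          rfl
        have : Unique (({v} : Finset V) : Set V) := by
          rw [Finset.coe_singleton]
          infer_instance
        exact ⟨g, hg, IsBuilt.vertex _ _⟩
      · obtain ⟨lab, hlab, hb⟩ := ih _ (Finset.erase_ssubset hv) h0 (by
          intro u hu w hw
          rw [Finset.mem_erase] at hu hw
          by_cases h : w ∈ P
          · obtain rfl : w = v := by tauto
            exact hmax u hu.2
          · exact hP u hu.2 w h)
        have hrep : ∀ a : C, ∃ r : V, (∃ u ∈ P.erase v, lab u = a) → r ∈ P.erase v ∧ lab r = a := by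
          intro a
          by_cases h : ∃ u ∈ P.erase v, lab u = a
          · obtain ⟨u, hu⟩ := h
            exact ⟨u, fun _ => hu⟩
          · exact ⟨v, fun h' => absurd h' h⟩
        choose r hr using hrep
        have hr' : ∀ u ∈ P.erase v, r (lab u) ∈ P.erase v ∧ lab (r (lab u)) = lab u :=
          fun u hu => hr _ ⟨u, hu, rfl⟩
        -- Only whole label classes can be renamed, so an old vertex takes the new type of its class
        -- representative; both have the same neighbours outside `P`.
        refine ⟨fun u => if u = v then g v else g (r (lab u)), ?_, ?_⟩
        · have hrepr : ∀ u ∈ P, ∃ u₁ ∈ P, (if u = v then g v else g (r (lab u))) = g u₁ ∧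
              ∀ w ∉ P, G.Adj u w ↔ G.Adj u₁ w := by
            intro u hu
            by_cases h : u = v
            · exact ⟨v, hv, by simp [h], by simp [h]⟩
            · have hu' : u ∈ P.erase v := Finset.mem_erase.2 ⟨h, hu⟩
              refine ⟨r (lab u), Finset.mem_of_mem_erase (hr' u hu').1, by simp [h], ?_⟩
              intro w hw
              exact hlab u hu' _ (hr' u hu').1 (hr' u hu').2.symm w
                fun h => hw (Finset.mem_of_mem_erase h)
          intro u hu u' hu' he w hw
          obtain ⟨a, ha, ha1, ha2⟩ := hrepr u hu
          obtain ⟨b, hb, hb1, hb2⟩ := hrepr u' hu'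
          rw [ha2 w hw, hb2 w hw]
          exact hg a ha b hb (by rw [← ha1, ← hb1]; exact he) w hw
        · have := hb.insert_vertex (v := v) (by simp)
            (fun u hu u' hu' h => hlab u hu u' hu' h v (by simp)) (fun a => g (r a)) (g v)
            (lab' := fun u => if u = v then g v else g (r (lab u)))
            (by
              intro u hu
              simp only [Finset.mem_coe, Finset.mem_erase] at hu
              simp [hu.1]) (by simp)
          rwa [← Finset.coe_insert, Finset.insert_erase hv] at this
  obtain ⟨lab, -, hb⟩ := main Finset.univ Finset.univ_nonempty (by simp)
  rw [Finset.coe_univ] at hb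
  have := (hb.of_iso (SimpleGraph.induceUnivIso G).symm).cliqueWidth_le
  refine this.trans ?_
  rw [Fintype.card_option, Fintype.card_sum, two_mul]

/-! ### Levels, phases and ancestors -/

/-- A representation of `G` by levels and phases: every level is a clique, `u` on one level and `v`
on the next one are adjacent exactly when the phase of `v` is at most that of `u`, and there are no
other edges. -/
structure Layering {V : Type*} (G : SimpleGraph V) where
  lev : V → ℤ
  ph : V → ℝ
  ph_lt : ∀ v, ph v < 1
  adj_iff : ∀ u v, G.Adj u v ↔ u ≠ v ∧ (lev u = lev v ∨ (lev v = lev u + 1 ∧ ph v ≤ ph u) ∨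
    (lev u = lev v + 1 ∧ ph u ≤ ph v))

theorem IsUnitIntervalGraph.exists_layering {V : Type*} {G : SimpleGraph V}
    (h : IsUnitIntervalGraph G) : Nonempty (Layering G) := by
  obtain ⟨l, hl⟩ := h
  refine ⟨⟨fun v => ⌊l v⌋, fun v => Int.fract (l v), fun v => Int.fract_lt_one _, fun u v => ?_⟩⟩
  have h1 : (Set.Icc (l u) (l u + 1) ∩ Set.Icc (l v) (l v + 1)).Nonempty ↔
      l u ≤ l v + 1 ∧ l v ≤ l u + 1 := by
    rw [Set.Icc_inter_Icc, Set.nonempty_Icc]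
    simp [and_comm]
  rw [hl, h1]
  refine and_congr_right fun _ => ?_
  have hu := Int.floor_add_fract (l u)
  have hv := Int.floor_add_fract (l v)
  have hu0 := Int.fract_nonneg (l u)
  have hv0 := Int.fract_nonneg (l v)
  have hu1 := Int.fract_lt_one (l u)
  have hv1 := Int.fract_lt_one (l v)
  generalize Int.fract (l u) = x at *
  generalize Int.fract (l v) = y at *
  generalize ⌊l u⌋ = a at *
  generalize ⌊l v⌋ = b at *
  rw [← hu, ← hv]
  constructor
  · rintro ⟨h2, h3⟩
    have h4 : a < b + 2 := by
      have : (a : ℝ) < b + 2 := by linarith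
      exact_mod_cast this
    have h5 : b < a + 2 := by
      have : (b : ℝ) < a + 2 := by linarith
      exact_mod_cast this
    obtain h6 | h6 | h6 : a = b ∨ b = a + 1 ∨ a = b + 1 := by omega
    · exact Or.inl h6
    · subst h6
      push_cast at h3
      exact Or.inr (Or.inl ⟨rfl, by linarith⟩)
    · subst h6
      push_cast at h2
      exact Or.inr (Or.inr ⟨rfl, by linarith⟩)
  · rintro (rfl | ⟨rfl, h⟩ | ⟨rfl, h⟩)
    · constructor <;> linarith
    · push_cast
      constructor <;> linarith
    · push_cast
      constructor <;> linarith

namespace Layering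

variable {V : Type*} {G : SimpleGraph V} (Λ : Layering G)

theorem adj_of_lev_eq {u v : V} (huv : u ≠ v) (h : Λ.lev u = Λ.lev v) : G.Adj u v :=
  (Λ.adj_iff u v).2 ⟨huv, Or.inl h⟩

theorem adj_iff_of_lev {u v : V} (h : Λ.lev v = Λ.lev u + 1) : G.Adj u v ↔ Λ.ph v ≤ Λ.ph u := by
  have h1 : u ≠ v := by
    rintro rfl
    omega
  rw [Λ.adj_iff]
  constructor
  · rintro ⟨-, h2 | h2 | h2⟩
    · omega
    · exact h2.2
    · omega
  · exact fun h2 => ⟨h1, Or.inr (Or.inl ⟨h, h2⟩)⟩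

theorem adj_lev {u v : V} (h : G.Adj u v) :
    Λ.lev u = Λ.lev v ∨ Λ.lev v = Λ.lev u + 1 ∨ Λ.lev u = Λ.lev v + 1 := by
  rcases ((Λ.adj_iff u v).1 h).2 with h | h | h
  · exact Or.inl h
  · exact Or.inr (Or.inl h.1)
  · exact Or.inr (Or.inr h.1)

/-- The least phase on level `i` that is at least `x`, or `1` if there is none: the phase of the
leftmost vertex on level `i` adjacent to a vertex with phase `x` on level `i + 1`. -/
noncomputable def up (i : ℤ) (x : ℝ) : ℝ :=
  sInf (insert 1 {y | (∃ v, Λ.lev v = i ∧ Λ.ph v = y) ∧ x ≤ y})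

/-- The ancestor on level `j - n` of the phase `x` on level `j`. -/
noncomputable def anc (j : ℤ) : ℕ → ℝ → ℝ
  | 0, x => x
  | n + 1, x => Λ.up (j - n - 1) (anc j n x)

theorem anc_succ' (j : ℤ) (n : ℕ) (x : ℝ) :
    Λ.anc j (n + 1) x = Λ.anc (j - 1) n (Λ.up (j - 1) x) := by
  induction n with
  | zero => simp [anc]
  | succ n ih =>
    rw [anc, ih, anc]
    congr 1
    push_cast
    ring

/-- The phases on level `i` (together with `1`) that have a descendant on level `i + q`. -/
def tall (q : ℕ) (i : ℤ) : Set ℝ :=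
  insert 1 {t | ∃ v, Λ.lev v = i + q ∧ Λ.anc (i + q) q (Λ.ph v) = t}

theorem anc_mem_tall (q : ℕ) (v : V) : Λ.anc (Λ.lev v) q (Λ.ph v) ∈ Λ.tall q (Λ.lev v - q) :=
  Set.mem_insert_of_mem _ ⟨v, by ring, by congr 1; ring⟩

open Classical in
/-- The distance from `v` to its nearest tall ancestor. -/
noncomputable def depth (q : ℕ) (v : V) : ℕ :=
  Nat.find (p := fun n : ℕ => Λ.anc (Λ.lev v) n (Λ.ph v) ∈ Λ.tall q (Λ.lev v - n))
    ⟨q, Λ.anc_mem_tall q v⟩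

theorem depth_le (q : ℕ) (v : V) : Λ.depth q v ≤ q := by
  classical
  exact Nat.find_min' _ (Λ.anc_mem_tall q v)

/-- The level of the nearest tall ancestor. -/
noncomputable def base (q : ℕ) (v : V) : ℤ := Λ.lev v - Λ.depth q v

/-- The key by which the vertices are sorted. -/
noncomputable def key (q : ℕ) (v : V) : ℤ ×ₗ ℝ ×ₗ ℤ :=
  toLex (Λ.base q v, toLex (Λ.ph v, -Λ.lev v))

theorem base_le_of_key_le {q : ℕ} {u w : V} (h : Λ.key q u ≤ Λ.key q w) :
    Λ.base q u ≤ Λ.base q w :=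
  (Prod.Lex.toLex_le_toLex'.1 h).1

/-- The order of phases settles adjacency between consecutive levels. Equal phases would be the
exception, and the component `-lev` of the key breaks such ties by putting the higher level first.
-/
theorem adj_iff_of_key_le {q : ℕ} {u w : V} (h : Λ.key q u ≤ Λ.key q w) (hne : u ≠ w)
    (hb : Λ.base q u = Λ.base q w) :
    G.Adj u w ↔ Λ.lev u = Λ.lev w ∨ Λ.lev u = Λ.lev w + 1 := by
  have h1 := Prod.Lex.toLex_le_toLex'.1 ((Prod.Lex.toLex_le_toLex'.1 h).2 hb)
  simp only [neg_le_neg_iff] at h1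
  rw [Λ.adj_iff]
  constructor
  · rintro ⟨-, h2 | ⟨h2, h3⟩ | h2⟩
    · exact Or.inl h2
    · have := h1.2 (le_antisymm h1.1 h3)
      omega
    · exact Or.inr h2.1
  · rintro (h2 | h2)
    · exact ⟨hne, Or.inl h2⟩
    · exact ⟨hne, Or.inr (Or.inr ⟨h2, h1.1⟩)⟩

section Finite

variable [Finite V]

theorem finite_up_set (i : ℤ) (x : ℝ) :
    (insert 1 {y | (∃ v, Λ.lev v = i ∧ Λ.ph v = y) ∧ x ≤ y}).Finite := by
  refine Set.Finite.insert _ ((Set.finite_range Λ.ph).subset ?_)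
  rintro y ⟨⟨v, -, rfl⟩, -⟩
  exact ⟨v, rfl⟩

theorem up_mem (i : ℤ) (x : ℝ) :
    Λ.up i x = 1 ∨ ((∃ v, Λ.lev v = i ∧ Λ.ph v = Λ.up i x) ∧ x ≤ Λ.up i x) :=
  (Set.insert_nonempty _ _).csInf_mem (Λ.finite_up_set i x)

theorem up_le_one (i : ℤ) (x : ℝ) : Λ.up i x ≤ 1 :=
  csInf_le (Λ.finite_up_set i x).bddBelow (Set.mem_insert _ _)

theorem up_le {i : ℤ} {x : ℝ} {v : V} (hv : Λ.lev v = i) (hx : x ≤ Λ.ph v) : Λ.up i x ≤ Λ.ph v :=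
  csInf_le (Λ.finite_up_set i x).bddBelow (Set.mem_insert_of_mem _ ⟨⟨v, hv, rfl⟩, hx⟩)

theorem le_up {i : ℤ} {x : ℝ} (hx : x ≤ 1) : x ≤ Λ.up i x := by
  rcases Λ.up_mem i x with h | h
  · rwa [h]
  · exact h.2

theorem up_one (i : ℤ) : Λ.up i 1 = 1 := le_antisymm (Λ.up_le_one i 1) (Λ.le_up le_rfl)

theorem up_mono (i : ℤ) : Monotone (Λ.up i) := by
  intro x y hxy
  rcases Λ.up_mem i y with h | ⟨⟨v, hv, hv'⟩, h⟩
  · rw [h]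
    exact Λ.up_le_one i x
  · rw [← hv'] at h ⊢
    exact Λ.up_le hv (hxy.trans h)

theorem anc_mono (j : ℤ) (n : ℕ) : Monotone (Λ.anc j n) := by
  induction n with
  | zero => exact monotone_id
  | succ n ih => exact (Λ.up_mono _).comp ih

theorem anc_one (j : ℤ) (n : ℕ) : Λ.anc j n 1 = 1 := by
  induction n with
  | zero => rfl
  | succ n ih => rw [anc, ih, up_one]

theorem anc_mem (j : ℤ) (n : ℕ) (v : V) (hv : Λ.lev v = j) :
    Λ.anc j n (Λ.ph v) = 1 ∨ ∃ w, Λ.lev w = j - n ∧ Λ.ph w = Λ.anc j n (Λ.ph v) := by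
  cases n with
  | zero => exact Or.inr ⟨v, by simp [hv], rfl⟩
  | succ n =>
    rw [anc]
    refine (Λ.up_mem _ _).imp_right fun h => ?_
    obtain ⟨w, hw, hw'⟩ := h.1
    exact ⟨w, by push_cast; omega, hw'⟩

theorem anc_eq_one_of_le {j : ℤ} {m n : ℕ} {x : ℝ} (hmn : m ≤ n) (h : Λ.anc j m x = 1) :
    Λ.anc j n x = 1 := by
  induction n, hmn using Nat.le_induction with
  | base => exact h
  | succ n _ ih => rw [anc, ih, up_one]

theorem finite_tall (q : ℕ) (i : ℤ) : (Λ.tall q i).Finite := by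
  refine Set.Finite.insert _ ((Set.finite_range fun v => Λ.anc (i + q) q (Λ.ph v)).subset ?_)
  rintro y ⟨v, -, rfl⟩
  exact ⟨v, rfl⟩

/-- Moving both a tall phase and its witness one level back preserves their distance; if the witness
has no parent, the result is `1`. -/
theorem up_mem_tall {q : ℕ} {i : ℤ} {t : ℝ} (h : t ∈ Λ.tall q (i + 1)) :
    Λ.up i t ∈ Λ.tall q i := by
  rcases h with rfl | ⟨v, hv, rfl⟩
  · rw [up_one]
    exact Set.mem_insert _ _
  · have h1 : Λ.up i (Λ.anc (i + 1 + q) q (Λ.ph v)) =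
        Λ.anc (i + q) q (Λ.up (i + q) (Λ.ph v)) := by
      have h2 := Λ.anc_succ' (i + 1 + q) q (Λ.ph v)
      rw [anc] at h2
      convert h2 using 2
      · ring
      · ring
      · congr 1
        ring
    rw [h1]
    rcases Λ.up_mem (i + q) (Λ.ph v) with h2 | ⟨⟨w, hw, hw'⟩, -⟩
    · rw [h2, anc_one]
      exact Set.mem_insert _ _
    · exact Set.mem_insert_of_mem _ ⟨w, hw, by rw [hw']⟩

/-- Disjoint ancestor chains of `q + 1` vertices over `q + 1` levels form an induced canonical
graph. -/
theorem ncard_tall_le {q : ℕ} (hG : ¬ (canonicalGraph (q + 1) (q + 1)).IsIndContained G) (i : ℤ) :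
    (Λ.tall q i).ncard ≤ q + 1 := by
  classical
  by_contra! hcard
  apply hG
  -- The sentinel `1` is discarded, so that the chosen phases belong to vertices.
  let T : Finset ℝ := (Λ.finite_tall q i).toFinset.erase 1
  have hT : q + 1 ≤ T.card := by
    rw [Finset.card_erase_of_mem (by simp [tall]), ← Set.ncard_eq_toFinset_card _ _]
    omega
  let t : Fin (q + 1) ↪o ℝ := T.orderEmbOfCardLe hT
  have ht : ∀ a, t a ≠ 1 ∧ ∃ v, Λ.lev v = i + q ∧ Λ.anc (i + q) q (Λ.ph v) = t a := by
    intro a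
    have := T.orderEmbOfCardLe_mem hT a
    rw [Finset.mem_erase, Set.Finite.mem_toFinset] at this
    exact ⟨this.1, this.2.resolve_left this.1⟩
  choose ht1 x hx hxt using ht
  have hw : ∀ s a : Fin (q + 1), ∃ w, Λ.lev w = i + s ∧
      Λ.ph w = Λ.anc (i + q) (q - s) (Λ.ph (x a)) := by
    intro s a
    rcases Λ.anc_mem (i + q) (q - s) (x a) (hx a) with h | ⟨w, hw, hw'⟩
    · exact absurd ((hxt a).symm.trans (Λ.anc_eq_one_of_le (Nat.sub_le q s) h)) (ht1 a)
    · have := s.is_lt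
      exact ⟨w, by omega, hw'⟩
  choose w hwl hwp using hw
  have hxmono : ∀ {a b}, a < b → Λ.ph (x a) ≤ Λ.ph (x b) := by
    intro a b hab
    by_contra! h
    have := Λ.anc_mono (i + q) q h.le
    rw [hxt, hxt, t.le_iff_le] at this
    exact absurd hab (not_lt.2 this)
  -- Chains that meet stay merged further back, contradicting distinct ends on level `i`.
  have hlt : ∀ s {a b}, a < b → Λ.ph (w s a) < Λ.ph (w s b) := by
    intro s a b hab
    rw [hwp, hwp]
    refine lt_of_le_of_ne (Λ.anc_mono _ _ (hxmono hab)) fun h => ?_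
    have : ∀ n, q - (s : ℕ) ≤ n →
        Λ.anc (i + q) n (Λ.ph (x a)) = Λ.anc (i + q) n (Λ.ph (x b)) := by
      intro n hn
      induction n, hn using Nat.le_induction with
      | base => exact h
      | succ n _ ih => rw [anc, anc, ih]
    have h2 := this q (Nat.sub_le q s)
    rw [hxt, hxt] at h2
    exact hab.ne (t.injective h2)
  have hstep : ∀ {s s' : Fin (q + 1)}, (s : ℕ) + 1 = s' → ∀ a,
      Λ.ph (w s a) = Λ.up (i + s) (Λ.ph (w s' a)) := by
    intro s s' hs a
    have := s'.is_lt
    rw [hwp, hwp, show q - (s : ℕ) = (q - (s' : ℕ)) + 1 by omega, anc]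
    congr 1
    omega
  have hadj : ∀ {s s' : Fin (q + 1)}, (s : ℕ) + 1 = s' → ∀ a b,
      G.Adj (w s a) (w s' b) ↔ b ≤ a := by
    intro s s' hs a b
    rw [Λ.adj_iff_of_lev (by rw [hwl, hwl]; omega)]
    constructor
    · intro h
      by_contra! hab
      have h2 := Λ.up_le (hwl s a) h
      rw [← hstep hs] at h2
      exact absurd (hlt s hab) (not_lt.2 h2)
    · intro h
      have h1 : Λ.ph (w s' b) ≤ Λ.ph (w s' a) := by
        rcases h.eq_or_lt with rfl | h
        · exact le_rfl
        · exact (hlt s' h).le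
      rw [hstep hs]
      exact h1.trans (Λ.le_up (Λ.ph_lt _).le)
  have hinj : ∀ s s' a b, w s a = w s' b → s = s' ∧ a = b := by
    intro s s' a b h
    obtain rfl : s = s' := by
      have := hwl s a
      rw [h, hwl] at this
      omega
    refine ⟨rfl, ?_⟩
    rcases lt_trichotomy a b with hab | hab | hab
    · exact absurd (hlt s hab) (by rw [h]; exact lt_irrefl _)
    · exact hab
    · exact absurd (hlt s hab) (by rw [h]; exact lt_irrefl _)
  refine ⟨⟨⟨fun p => w p.1 p.2, ?_⟩, ?_⟩⟩
  · rintro ⟨s, a⟩ ⟨s', b⟩ h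
    exact Prod.ext_iff.2 (hinj _ _ _ _ h)
  · rintro ⟨s, a⟩ ⟨s', b⟩
    change G.Adj (w s a) (w s' b) ↔ _
    simp only [canonicalGraph, SimpleGraph.fromRel_adj, ne_eq,
      Prod.mk.injEq]
    constructor
    · intro h
      refine ⟨fun h' => h.ne (by rw [h'.1, h'.2]), ?_⟩
      rcases Λ.adj_lev h with h1 | h1 | h1
      · left; left
        rw [hwl, hwl] at h1
        omega
      · rw [hwl, hwl] at h1
        have h2 : (s : ℕ) + 1 = s' := by omega
        exact Or.inl (Or.inr ⟨h2, (hadj h2 a b).1 h⟩)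
      · rw [hwl, hwl] at h1
        have h2 : (s' : ℕ) + 1 = s := by omega
        exact Or.inr (Or.inr ⟨h2, (hadj h2 b a).1 h.symm⟩)
    · rintro ⟨hne, (rfl | ⟨h1, h2⟩) | rfl | ⟨h1, h2⟩⟩
      · exact Λ.adj_of_lev_eq (fun h => hne (hinj _ _ _ _ h)) (by rw [hwl, hwl])
      · exact (hadj h1 a b).2 h2
      · exact Λ.adj_of_lev_eq (fun h => hne (hinj _ _ _ _ h)) (by rw [hwl, hwl])
      · exact ((hadj h1 b a).2 h2).symm

theorem anc_mem_tall_iff (q : ℕ) (v : V) (n : ℕ) :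
    Λ.anc (Λ.lev v) n (Λ.ph v) ∈ Λ.tall q (Λ.lev v - n) ↔ Λ.depth q v ≤ n := by
  classical
  constructor
  · exact fun h => Nat.find_min' _ h
  · intro h
    induction n, h using Nat.le_induction with
    | base =>
      exact Nat.find_spec (p := fun n : ℕ => Λ.anc (Λ.lev v) n (Λ.ph v) ∈ Λ.tall q (Λ.lev v - n))
        ⟨q, Λ.anc_mem_tall q v⟩
    | succ n _ ih =>
      rw [anc]
      have := Λ.up_mem_tall (q := q) (i := Λ.lev v - n - 1) (by rwa [sub_add_cancel])
      convert this using 2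
      push_cast
      ring

/-! ### Neighbourhood types of vertices -/

/-- The tall phases on the level below the nearest tall ancestor of `v` that lie before the
ancestor of `v` on that level (or before `v`, if `v` itself is tall). -/
def before (q : ℕ) (v : V) : Set ℝ :=
  {t ∈ Λ.tall q (Λ.base q v + 1) | t ≤ Λ.anc (Λ.lev v) (Λ.depth q v - 1) (Λ.ph v)}

theorem finite_before (q : ℕ) (v : V) : (Λ.before q v).Finite :=
  (Λ.finite_tall q _).subset (Set.sep_subset _ _)

/-- The number of tall phases that come before `v` on the level below its nearest tall ancestor. -/
noncomputable def rank (q : ℕ) (v : V) : ℕ := (Λ.before q v).ncard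

theorem before_eq {q : ℕ} {u v : V} (hl : Λ.lev u = Λ.lev v) (hd : Λ.depth q u = Λ.depth q v)
    (hr : Λ.rank q u = Λ.rank q v) : Λ.before q u = Λ.before q v := by
  have hb : Λ.base q u = Λ.base q v := by rw [base, base, hl, hd]
  have key : Λ.before q u ⊆ Λ.before q v ∨ Λ.before q v ⊆ Λ.before q u := by
    rw [before, before, hb, hl, hd]
    rcases le_total (Λ.anc (Λ.lev v) (Λ.depth q v - 1) (Λ.ph u))
      (Λ.anc (Λ.lev v) (Λ.depth q v - 1) (Λ.ph v)) with h | h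
    · exact Or.inl fun t ht => ⟨ht.1, ht.2.trans h⟩
    · exact Or.inr fun t ht => ⟨ht.1, ht.2.trans h⟩
  rcases key with h | h
  · exact Set.eq_of_subset_of_ncard_le h hr.ge (Λ.finite_before q v)
  · exact (Set.eq_of_subset_of_ncard_le h hr.le (Λ.finite_before q u)).symm

theorem rank_le {q : ℕ} (hG : ¬ (canonicalGraph (q + 1) (q + 1)).IsIndContained G) (v : V) :
    Λ.rank q v ≤ q + 1 :=
  (Set.ncard_le_ncard (Set.sep_subset _ _) (Λ.finite_tall q _)).trans (Λ.ncard_tall_le hG _)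

/-- Vertices with the same level, depth and rank have the same neighbours among the vertices with a
larger base. -/
theorem adj_of_base_lt {q : ℕ} {u v w : V} (hl : Λ.lev u = Λ.lev v)
    (hd : Λ.depth q u = Λ.depth q v) (hr : Λ.rank q u = Λ.rank q v)
    (hw : Λ.base q u < Λ.base q w) (h : G.Adj u w) : G.Adj v w := by
  have hbef := Λ.before_eq hl hd hr
  have hne : v ≠ w := by
    rintro rfl
    simp only [base] at hw
    omega
  have hb : Λ.base q u = Λ.base q v := by rw [base, base, hl, hd]
  -- the ancestor of `w` on level `base + 1` is tall
  have hwt : ∀ n : ℕ, (n : ℤ) = Λ.lev w - (Λ.base q v + 1) →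
      Λ.anc (Λ.lev w) n (Λ.ph w) ∈ Λ.tall q (Λ.base q v + 1) := by
    intro n hn
    have h1 : Λ.depth q w ≤ n := by
      simp only [base] at *
      omega
    convert (Λ.anc_mem_tall_iff q w n).2 h1 using 2
    omega
  have hnt : ∀ x : V, ∀ n, Λ.depth q x = n + 1 →
      Λ.anc (Λ.lev x) n (Λ.ph x) ∉ Λ.tall q (Λ.base q x + 1) := by
    intro x n hn h'
    have := (Λ.anc_mem_tall_iff q x n).1 (by
      convert h' using 2
      simp only [base, hn]
      push_cast
      ring)
    omega
  have htr : ∀ t ∈ Λ.tall q (Λ.base q v + 1),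
      t ≤ Λ.anc (Λ.lev v) (Λ.depth q v - 1) (Λ.ph u) →
      t ≤ Λ.anc (Λ.lev v) (Λ.depth q v - 1) (Λ.ph v) := by
    intro t ht htu
    have : t ∈ Λ.before q u := ⟨hb ▸ ht, by rwa [hl, hd]⟩
    rw [hbef] at this
    exact this.2
  have htr' : ∀ t ∈ Λ.tall q (Λ.base q v + 1),
      t ≤ Λ.anc (Λ.lev v) (Λ.depth q v - 1) (Λ.ph v) →
      t ≤ Λ.anc (Λ.lev v) (Λ.depth q v - 1) (Λ.ph u) := by
    intro t ht htv
    have : t ∈ Λ.before q v := ⟨ht, htv⟩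
    rw [← hbef, before, hl, hd] at this
    exact this.2
  rcases Λ.adj_lev h with h1 | h1 | h1
  · exact Λ.adj_of_lev_eq hne (hl ▸ h1)
  · rw [Λ.adj_iff_of_lev h1] at h
    have h1' : Λ.lev w = Λ.lev v + 1 := by omega
    rw [Λ.adj_iff_of_lev h1']
    -- Otherwise the ancestor of `w` on level `base + 1` is tall and, by equality of ranks, at most
    -- that of `v`; monotonicity gives the reverse inequality. So `v` would have a tall ancestor
    -- nearer than its depth allows. At depth `0` the phases are compared directly.
    by_contra! hlt
    rcases Nat.eq_zero_or_pos (Λ.depth q v) with h0 | h0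
    · have h2 := htr (Λ.ph w) (hwt 0 (by simp only [base]; omega))
        (by simpa [h0, anc] using h)
      simp only [h0] at h2
      exact absurd hlt (not_lt.2 h2)
    · obtain ⟨n, hn⟩ := Nat.exists_eq_succ_of_ne_zero h0.ne'
      have h2 := hwt (n + 1) (by simp only [base, hn]; push_cast; omega)
      rw [anc_succ', h1', add_sub_cancel_right] at h2
      have h3 := Λ.anc_mono (Λ.lev v) n (Λ.up_le hl h)
      have h4 := htr _ h2 (by rw [hn]; exact h3)
      have h5 := Λ.anc_mono (Λ.lev v) n (hlt.le.trans (Λ.le_up (i := Λ.lev v) (Λ.ph_lt w).le))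
      rw [hn] at h4
      exact hnt v n hn (by rwa [le_antisymm h5 h4])
  · have h1' : Λ.lev v = Λ.lev w + 1 := by omega
    rw [G.adj_comm, Λ.adj_iff_of_lev h1] at h
    rw [G.adj_comm, Λ.adj_iff_of_lev h1']
    -- The same squeeze with the order reversed, now making the ancestor of `u` tall. Here the depth
    -- is at least `2`, as `w` itself lies above the base.
    by_contra! hlt
    have h0 : Λ.depth q v ≠ 0 := by
      intro h0
      simp only [base] at hw
      omega
    obtain ⟨n, hn⟩ := Nat.exists_eq_succ_of_ne_zero h0
    obtain ⟨m, rfl⟩ : ∃ m, n = m + 1 := by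
      refine Nat.exists_eq_succ_of_ne_zero ?_
      rintro rfl
      simp only [base] at hw
      omega
    have h2 := hwt m (by simp only [base, hn]; push_cast; omega)
    have h3 := Λ.anc_mono (Λ.lev w) m (Λ.up_le rfl h)
    have h4 := Λ.anc_mono (Λ.lev w) m (hlt.le.trans (Λ.le_up (i := Λ.lev w) (Λ.ph_lt v).le))
    have h5 : ∀ x, Λ.anc (Λ.lev v) (m + 1) x = Λ.anc (Λ.lev w) m (Λ.up (Λ.lev w) x) := by
      intro x
      rw [anc_succ', h1', add_sub_cancel_right]
    rw [← h5] at h3 h4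
    have h6 := htr' _ h2 (by rw [hn]; exact h4)
    rw [hn] at h6
    have h7 := le_antisymm h3 h6
    have h8 := hnt u (m + 1) (by omega)
    rw [hl, hb] at h8
    exact h8 (by rwa [h7])

/-- The type of a vertex is its depth, its base relative to the largest base in the segment, and its
rank; one further type serves vertices too low to have neighbours outside. -/
theorem cliqueWidth_le (Λ : Layering G) {q : ℕ} (hG : ¬ (canonicalGraph (q + 1) (q + 1)).IsIndContained G) :
    cliqueWidth G ≤ ((2 * ((q + 1) * (q + 2) * (q + 2) + 1) + 1 : ℕ) : ℕ∞) := by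
  classical
  have main := cliqueWidth_le_of_initial_classes
    (C := Option ((Fin (q + 1) × Fin (q + 2)) × Fin (q + 2))) G (Λ.key q) ?_
  · simpa using main
  intro P hP hinit
  obtain ⟨z, hz, hmax⟩ := Set.exists_max_image P (Λ.base q) P.toFinite hP
  have hge : ∀ w ∉ P, Λ.base q z ≤ Λ.base q w := fun w hw =>
    Λ.base_le_of_key_le (hinit z hz w hw)
  have hlev : ∀ w, Λ.base q w ≤ Λ.lev w := fun w => by
    simp only [base]
    omega
  -- For the remaining vertices nothing wraps around in `Fin.ofNat`: `lev u ≥ base z - 1` and `depth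
  -- ≤ q` keep the base offset at most `q + 1`.
  refine ⟨fun u => if Λ.lev u < Λ.base q z - 1 then none else
    some ((Fin.ofNat _ (Λ.depth q u), Fin.ofNat _ (Λ.base q z - Λ.base q u).toNat),
      Fin.ofNat _ (Λ.rank q u)), ?_⟩
  have dead : ∀ u, Λ.lev u < Λ.base q z - 1 → ∀ w ∉ P, ¬ G.Adj u w := by
    intro u hu w hw h
    have h1 := hge w hw
    have h2 := hlev w
    rcases Λ.adj_lev h with h | h | h <;> omega
  intro u hu v hv huv w hw
  by_cases h1 : Λ.lev u < Λ.base q z - 1 <;> by_cases h2 : Λ.lev v < Λ.base q z - 1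
  · exact iff_of_false (dead u h1 w hw) (dead v h2 w hw)
  · simp [h1, h2] at huv
  · simp [h1, h2] at huv
  · simp only [h1, h2, if_false, Option.some.injEq, Prod.mk.injEq, Fin.ext_iff, Fin.ofNat] at huv
    obtain ⟨⟨hd, hb⟩, hr⟩ := huv
    have hdu := Λ.depth_le q u
    have hdv := Λ.depth_le q v
    have hru := Λ.rank_le hG u
    have hrv := Λ.rank_le hG v
    have hbu := hmax u hu
    have hbv := hmax v hv
    rw [Nat.mod_eq_of_lt (by omega), Nat.mod_eq_of_lt (by omega)] at hd hr
    have hbase : Λ.base q u = Λ.base q v := by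
      rw [Nat.mod_eq_of_lt (by simp only [base] at *; omega),
        Nat.mod_eq_of_lt (by simp only [base] at *; omega)] at hb
      omega
    have hl : Λ.lev u = Λ.lev v := by
      simp only [base] at hbase
      omega
    rcases (Λ.base_le_of_key_le (hinit u hu w hw)).eq_or_lt with h3 | h3
    · rw [Λ.adj_iff_of_key_le (hinit u hu w hw) (fun h => hw (h ▸ hu)) h3,
        Λ.adj_iff_of_key_le (hinit v hv w hw) (fun h => hw (h ▸ hv)) (hbase ▸ h3), hl]
    · exact ⟨Λ.adj_of_base_lt hl hd hr h3,
        Λ.adj_of_base_lt hl.symm hd.symm hr.symm (hbase ▸ h3)⟩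

end Finite

end Layering

theorem mainTheorem2 :
    ∃ c : ℕ → ℕ,
      (∀ k : ℕ, (c k : ℤ) = 12 * (k : ℤ) ^ 3 + 72 * (k : ℤ) ^ 2 - 36 * (k : ℤ) + 96) ∧
      ∀ (k : ℕ) (V : Type*) [Finite V] (G : SimpleGraph V),
        IsUnitIntervalGraph G →
        ¬ (canonicalGraph k k).IsIndContained G →
        cliqueWidth G ≤ (c k : ℕ∞) := by
  have hnn : ∀ k : ℕ, 0 ≤ 12 * (k : ℤ) ^ 3 + 72 * (k : ℤ) ^ 2 - 36 * (k : ℤ) + 96 := by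
    intro k
    have : (0 : ℤ) ≤ (k : ℤ) ^ 3 := by positivity
    nlinarith [sq_nonneg ((k : ℤ) - 1)]
  refine ⟨fun k => (12 * (k : ℤ) ^ 3 + 72 * (k : ℤ) ^ 2 - 36 * (k : ℤ) + 96).toNat,
    fun k => Int.toNat_of_nonneg (hnn k), ?_⟩
  intro k V _ G hG hk
  obtain _ | q := k
  -- `H_{0,0}` has no vertices, so every graph contains it.
  · exact absurd ⟨⟨⟨fun p => p.1.elim0, fun p => p.1.elim0⟩, fun {p} => p.1.elim0⟩⟩ hk
  · obtain ⟨Λ⟩ := hG.exists_layering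
    -- With `k = q + 1` the bound obtained is `2k(k+1)^2 + 3`, well below the required one.
    refine (Λ.cliqueWidth_le hk).trans (Nat.cast_le.2 ?_)
    rw [← Int.ofNat_le, Int.toNat_of_nonneg (hnn _)]
    push_cast
    nlinarith [pow_nonneg (Int.natCast_nonneg q) 3, pow_nonneg (Int.natCast_nonneg q) 2]
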